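/- Let $A$ be a finite discrete alphabet, let $\sigma$ be the shift on $A^{\mathbb{Z}}$, $\sigma(\mathbf{a})_i=a_{i+1}$, and let $X=\overline{\{\sigma^k(\mathbf{x}):k\in\mathbb{Z}\}}\subseteq A^{\mathbb{Z}}$ be a minimal subshift, where $\mathbf{x}\in A^{\mathbb{Z}}$ is uniformly recurrent (for every $n$ there is $M$ such that every length-$n$ factor of $\mathbf{x}$ occurs in every length-$M$ factor of $\mathbf{x}$) and non-periodic. Let $p_X(n)$ be the number of distinct length-$n$ factors of $\mathbf{x}$. Let $[\![\sigma]\!]$ be the topological full group of $(X,\sigma)$, that is, the group of homeomorphisms $g$ of $X$ for which there is a continuous $f_g:X\to\mathbb{Z}$ with $g(y)=\sigma^{f_g(y)}(y)$ for all $y\in X$, and let $[\![\sigma]\!]'$ be its derived subgroup. For a finite generating set $S$ of a group $\Gamma$, let $B_S(n)$ be the set of elements of word length at most $n$ with respect to $S$, and let $\mathcal{L}^S_\Gamma(n)$ be the minimal order of a finite group $Q$ admitting a local embedding $\phi:B_S(n)\to Q$, i.e. an injective map such that $\phi(gh)=\phi(g)\phi(h)$ whenever $g,h,gh\in B_S(n)$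 (with the value $\infty$ if there were no such $Q$). Then there exists $c>0$ such that $\exp\big(c\,p_X(n^{1/2})\big)\preceq\mathcal{L}_{[\![\sigma]\!]'}(n)$; that is, there exists $c>0$ such that for every finite generating set $S$ of $[\![\sigma]\!]'$ there is a positive integer $C$ with $$\exp\big(c\,p_X(\lfloor n^{1/2}\rfloor)\big)\le \mathcal{L}^S_{[\![\sigma]\!]'}(Cn)\qquad\text{for all integers } n\ge 1.$$ -/

import Mathlib

open scoped ENNReal

namespace LEFGrowth

section Groups

variable {G : Type*} [Group G]

/-- A local embedding of the subset `F` of `G` into the group `Q`: an injective partial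
homomorphism. Only the values of `φ` on `F` matter. -/
structure IsLocalEmbeddingOn {Q : Type*} [Group Q] (F : Set G) (φ : G → Q) : Prop where
  map_mul : ∀ g ∈ F, ∀ h ∈ F, g * h ∈ F → φ (g * h) = φ g * φ h
  injOn : Set.InjOn φ F

/-- The closed ball `B_S(n)` of the word metric: the elements of `G` which are products of at
most `n` elements of `S ∪ S⁻¹`. -/
def wordBall (S : Set G) (n : ℕ) : Set G :=
  {g | ∃ l : List G, l.length ≤ n ∧ (∀ s ∈ l, s ∈ S ∨ s⁻¹ ∈ S) ∧ l.prod = g}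

/-- The LEF growth function of `G` with respect to `S`: the minimal order of a finite group into
which `B_S(n)` locally embeds. (It would be `⊤` if there were no such finite group.) -/
noncomputable def lefGrowth (S : Set G) (n : ℕ) : ℕ∞ :=
  sInf {k : ℕ∞ | ∃ (Q : Type) (_ : Group Q) (_ : Finite Q) (φ : G → Q),
    IsLocalEmbeddingOn (wordBall S n) φ ∧ k = (Nat.card Q : ℕ∞)}

end Groups

/-- `F₁ ⪯ F₂`: up to a constant rescaling of the (positive integer) argument, `F₂` bounds `F₁`
from above. -/
def GrowthLE (F₁ F₂ : ℕ → ℝ≥0∞) : Prop :=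
  ∃ C : ℕ, 0 < C ∧ ∀ n : ℕ, 0 < n → F₁ n ≤ F₂ (C * n)

section FullGroup

variable {X : Type*} [TopologicalSpace X]

/-- The topological full group `⟦φ⟧` of a homeomorphism `φ`, as a subgroup of the group of
self-homeomorphisms: `g` belongs to it iff it has a continuous orbit cocycle `f : X → ℤ`. -/
def topologicalFullGroup (φ : X ≃ₜ X) : Subgroup (X ≃ₜ X) where
  carrier := {g | ∃ f : X → ℤ, Continuous f ∧ ∀ y, g y = (φ ^ f y) y}
  one_mem' := ⟨fun _ => 0, continuous_const, fun y => by simp⟩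
  mul_mem' := by
    rintro g h ⟨f, hf, hg⟩ ⟨f', hf', hh⟩
    refine ⟨fun y => f (h y) + f' y, (hf.comp h.continuous).add hf', fun y => ?_⟩
    change g (h y) = _
    rw [hg (h y), zpow_add]
    change _ = (φ ^ f (h y)) ((φ ^ f' y) y)
    rw [← hh y]
  inv_mem' := by
    rintro g ⟨f, hf, hg⟩
    refine ⟨fun y => - f (g⁻¹ y), (hf.comp (g⁻¹).continuous).neg, fun y => ?_⟩
    have h1 : y = (φ ^ f (g⁻¹ y)) (g⁻¹ y) := by
      rw [← hg]
      change y = (g * g⁻¹) y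
      simp
    have h2 : (φ ^ (-f (g⁻¹ y))) y
        = (φ ^ (-f (g⁻¹ y)) * φ ^ f (g⁻¹ y)) (g⁻¹ y) := by
      change _ = (φ ^ (-f (g⁻¹ y))) ((φ ^ f (g⁻¹ y)) (g⁻¹ y))
      rw [← h1]
    rw [h2, ← zpow_add]
    simp

end FullGroup

section Words

variable {A : Type*}

/-- The set `F_n(x)` of `n`-factors of a bi-infinite word `x`. -/
def factors (x : ℤ → A) (n : ℕ) : Set (Fin n → A) :=
  {w | ∃ k : ℤ, ∀ i : Fin n, w i = x (k + (i : ℕ))}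

/-- The set `F_n(v)` of `n`-factors of a finite word `v`. -/
def wordFactors {M : ℕ} (v : Fin M → A) (n : ℕ) : Set (Fin n → A) :=
  {w | ∃ (k : ℕ) (hk : k + n ≤ M), ∀ i : Fin n, w i = v ⟨k + i, by omega⟩}

/-- The complexity function `p_x`, counting the `n`-factors of `x`. -/
noncomputable def complexity (x : ℤ → A) (n : ℕ) : ℕ := (factors x n).ncard

/-- `x` is uniformly recurrent: for each `n` there is `M` such that every `n`-factor of `x` occurs
in every `M`-factor of `x`. -/
def UniformlyRecurrent (x : ℤ → A) : Prop :=
  ∀ n : ℕ, ∃ M : ℕ, ∀ w ∈ factors x n, ∀ v ∈ factors x M, w ∈ wordFactors v n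

/-- `x` has no nonzero period. -/
def NonPeriodic (x : ℤ → A) : Prop := ∀ k : ℤ, k ≠ 0 → ¬ Function.Periodic x k

variable [TopologicalSpace A]

/-- The shift `σ` on bi-infinite words, `(σ a) i = a (i + 1)`. -/
def shift (A : Type*) [TopologicalSpace A] : (ℤ → A) ≃ₜ (ℤ → A) where
  toFun a i := a (i + 1)
  invFun a i := a (i - 1)
  left_inv a := by ext i; simp
  right_inv a := by ext i; simp
  continuous_toFun := by fun_prop
  continuous_invFun := by fun_prop

/-- The closure of the orbit of `x` under the shift. When `x` is uniformly recurrent and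
non-periodic, this is a minimal subshift, and every minimal subshift is of this form. -/
def orbitClosure (x : ℤ → A) : Set (ℤ → A) :=
  closure (Set.range fun k : ℤ => (shift A ^ k) x)

theorem mem_orbitClosure_iff_shift (x y : ℤ → A) :
    y ∈ orbitClosure x ↔ shift A y ∈ orbitClosure x := by
  have h : shift A ⁻¹' (Set.range fun k : ℤ => (shift A ^ k) x)
      = Set.range fun k : ℤ => (shift A ^ k) x := by
    ext z
    constructor
    · rintro ⟨k, hk⟩
      refine ⟨k - 1, (shift A).injective ?_⟩
      rw [← hk]
      change (shift A * shift A ^ (k - 1)) x = _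
      rw [← zpow_one_add]
      congr 2
      ring
    · rintro ⟨k, rfl⟩
      refine ⟨1 + k, ?_⟩
      change _ = (shift A * shift A ^ k) x
      rw [← zpow_one_add]
  change _ ↔ y ∈ shift A ⁻¹' orbitClosure x
  rw [orbitClosure, (shift A).preimage_closure, h]

/-- The shift `σ` restricted to the subshift `X = orbitClosure x`. -/
def subshift (x : ℤ → A) : orbitClosure x ≃ₜ orbitClosure x :=
  (shift A).subtype (mem_orbitClosure_iff_shift x)

/-- The derived subgroup `⟦σ⟧′` of the topological full group of the subshift generated
by `x`. -/
abbrev derivedFullGroup (x : ℤ → A) : Type _ :=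
  commutator (topologicalFullGroup (subshift x))

end Words

end LEFGrowth

/-!
The lower bound comes from two families of elements `a w`, `b w` of the derived subgroup such that
`a w` commutes with `b w'` exactly when `w ≠ w'`. Such a configuration with `r` indices survives
every local embedding of a ball containing all `a w` and `b w` with twice their length, and a
finite group `Q` that contains it has order at least `2 ^ r`: the centralizers of growing sets of
`b w` form a strictly decreasing chain of subgroups (`two_pow_card_le_natCard`,
`two_pow_card_le_lefGrowth`). So about `p_X(√n)` indices with word length `O(n)` are needed.

*The elements.* If `U, σ U, …, σ⁴ U` are disjoint, a permutation `π` of `{0, …, 4}` acts on `X` by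
permuting these levels (`IsTower.perm`); for `U` clopen this is an element of the full group, and
of its derived subgroup if `π` is even. By uniform recurrence and non-periodicity there is `N` such
that all cylinders of radius `N` are bases of such towers (`UniformlyRecurrent.exists_isTower`).
Over disjoint cylinders inside one cylinder of radius `N` the level permutations commute, and over
a single cylinder two three-cycles with different supports do not. By the pigeonhole principle some
cylinder of radius `N` contains at least `p_X(s) / |A| ^ (2N + 1)` disjoint cylinders of radius
`N + m`, for `s ≤ 2m` (`exists_positions`).

*The word length.* Inside a common tower, the commutator of a level permutation over `U` with one
over `V` is the level permutation over `U ∩ V` given by the commutator. As every three-cycle of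
five points is a commutator of three-cycles, three-cycles over `U ∩ V` are at most four times as
long as those over `U` and `V` (`IsTower.LengthLE.inter`). Passing from `U` to `σ U` costs only a
bounded amount (`IsTower.LengthLE.image`): a three-cycle over `σ U` that fixes the top level is a
three-cycle over `U`, and the others are conjugate to such a one by an even level permutation over
one of the finitely many cylinders of radius `N`. A cylinder of radius `N + 2m` is the intersection
of two cylinders obtained from cylinders of radius `N + m` by `m` shifts to the right or to the
left. Hence the maximal length `l (m)` over radius `N + m` satisfies `l (2m) ≤ 4 (l (m) + 2 c m)`,
so that `l (m) = O(m²)` along powers of two (`exists_lengthLE_cylinder`), and `m ≈ √n` is allowed.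
-/

namespace LEFGrowth

open Equiv
open scoped commutatorElement

/-! ### Counting with almost commuting families -/

/-- The centralizers of the sets `b '' s` strictly decrease as `s` grows, because `a i` centralizes
all `b j` except `b i`; each step at least halves the order. -/
theorem two_pow_card_le_natCard {Q ι : Type*} [Group Q] [Finite Q] (a b : ι → Q) (s : Finset ι)
    (hcomm : ∀ i ∈ s, ∀ j ∈ s, i ≠ j → a i * b j = b j * a i)
    (hne : ∀ i ∈ s, a i * b i ≠ b i * a i) : 2 ^ s.card ≤ Nat.card Q := by
  classical
  have key : ∀ t ⊆ s,
      2 ^ t.card * Nat.card (Subgroup.centralizer (b '' (t : Set ι))) ≤ Nat.card Q := by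
    intro t
    induction t using Finset.induction_on with
    | empty => intro _; simpa using Subgroup.card_le_card_group _
    | insert i t hi ih =>
      intro hts
      have hcs := (Finset.insert_subset_iff.1 hts)
      refine le_trans ?_ (ih hcs.2)
      rw [Finset.card_insert_of_notMem hi, pow_succ, mul_assoc]
      refine Nat.mul_le_mul_left _ ?_
      have hle : Subgroup.centralizer (b '' ((insert i t : Finset ι) : Set ι)) ≤
          Subgroup.centralizer (b '' (t : Set ι)) :=
        Subgroup.centralizer_le (Set.image_mono (by simp))
      have hai : a i ∈ Subgroup.centralizer (b '' (t : Set ι)) := by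
        rw [Subgroup.mem_centralizer_iff]
        rintro _ ⟨j, hj, rfl⟩
        exact (hcomm i hcs.1 j (hcs.2 hj) (fun h => hi (h ▸ hj))).symm
      have hai' : a i ∉ Subgroup.centralizer (b '' ((insert i t : Finset ι) : Set ι)) := by
        intro h
        rw [Subgroup.mem_centralizer_iff] at h
        exact hne i hcs.1 (h (b i) ⟨i, by simp, rfl⟩).symm
      obtain ⟨k, hk⟩ := Subgroup.card_dvd_of_le hle
      have hk0 : k ≠ 0 := by
        rintro rfl
        exact Nat.card_pos.ne' hk
      have hk1 : k ≠ 1 := by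
        rintro rfl
        rw [mul_one] at hk
        exact hai' ((Subgroup.eq_of_le_of_card_ge hle hk.le).symm ▸ hai)
      rw [hk, mul_comm]
      exact Nat.mul_le_mul_left _ (by omega)
  exact le_trans (Nat.le_mul_of_pos_right _ Nat.card_pos) (key s subset_rfl)

/-! ### Balls of a word metric -/

section WordBall

variable {G : Type*} [Group G] {S : Set G} {g h : G} {m n : ℕ}

theorem wordBall_mono (hmn : m ≤ n) (hg : g ∈ wordBall S m) : g ∈ wordBall S n := by
  obtain ⟨l, h1, h2, h3⟩ := hg
  exact ⟨l, h1.trans hmn, h2, h3⟩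

theorem mul_mem_wordBall (hg : g ∈ wordBall S m) (hh : h ∈ wordBall S n) :
    g * h ∈ wordBall S (m + n) := by
  obtain ⟨l, h1, h2, rfl⟩ := hg
  obtain ⟨l', h1', h2', rfl⟩ := hh
  refine ⟨l ++ l', by simp; omega, fun s hs => ?_, by simp⟩
  rcases List.mem_append.1 hs with hs | hs
  exacts [h2 s hs, h2' s hs]

theorem inv_mem_wordBall (hg : g ∈ wordBall S n) : g⁻¹ ∈ wordBall S n := by
  obtain ⟨l, h1, h2, rfl⟩ := hg
  refine ⟨(l.map fun x => x⁻¹).reverse, by simpa using h1, fun s hs => ?_,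
    (List.prod_inv_reverse l).symm⟩
  simp only [List.mem_reverse, List.mem_map] at hs
  obtain ⟨t, ht, rfl⟩ := hs
  simpa [or_comm] using h2 t ht

theorem exists_mem_wordBall (hS : Subgroup.closure S = ⊤) (g : G) : ∃ n, g ∈ wordBall S n := by
  have hg : g ∈ Subgroup.closure S := hS ▸ Subgroup.mem_top g
  induction hg using Subgroup.closure_induction with
  | mem s hs => exact ⟨1, [s], by simp, by simpa using Or.inl hs, by simp⟩
  | one => exact ⟨0, [], by simp, by simp, by simp⟩
  | mul _ _ _ _ h1 h2 =>
    obtain ⟨m, hm⟩ := h1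
    obtain ⟨n, hn⟩ := h2
    exact ⟨m + n, mul_mem_wordBall hm hn⟩
  | inv _ _ h1 =>
    obtain ⟨m, hm⟩ := h1
    exact ⟨m, inv_mem_wordBall hm⟩

/-- The radius `2n` guarantees that a local embedding preserves and reflects the commutation of
elements of length at most `n`. -/
theorem two_pow_card_le_lefGrowth {ι : Type*} (a b : ι → G) (s : Finset ι)
    (ha : ∀ i ∈ s, a i ∈ wordBall S n) (hb : ∀ i ∈ s, b i ∈ wordBall S n)
    (hcomm : ∀ i ∈ s, ∀ j ∈ s, i ≠ j → a i * b j = b j * a i)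
    (hne : ∀ i ∈ s, a i * b i ≠ b i * a i) (hm : 2 * n ≤ m) :
    ((2 ^ s.card : ℕ) : ℕ∞) ≤ lefGrowth S m := by
  refine le_sInf ?_
  rintro _ ⟨Q, _, _, φ, hφ, rfl⟩
  have hle : ∀ {g}, g ∈ wordBall S n → g ∈ wordBall S m := fun h => wordBall_mono (by omega) h
  have hmul : ∀ {g h}, g ∈ wordBall S n → h ∈ wordBall S n → g * h ∈ wordBall S m :=
    fun h1 h2 => wordBall_mono (by omega) (mul_mem_wordBall h1 h2)
  have hφmul : ∀ {g h}, g ∈ wordBall S n → h ∈ wordBall S n → φ (g * h) = φ g * φ h :=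
    fun h1 h2 => hφ.map_mul _ (hle h1) _ (hle h2) (hmul h1 h2)
  refine Nat.cast_le.2 (two_pow_card_le_natCard (φ ∘ a) (φ ∘ b) s ?_ ?_)
  · intro i hi j hj hij
    simp only [Function.comp_apply]
    rw [← hφmul (ha i hi) (hb j hj), hcomm i hi j hj hij, hφmul (hb j hj) (ha i hi)]
  · intro i hi h
    simp only [Function.comp_apply] at h
    rw [← hφmul (ha i hi) (hb i hi), ← hφmul (hb i hi) (ha i hi)] at h
    exact hne i hi (hφ.injOn (hmul (ha i hi) (hb i hi)) (hmul (hb i hi) (ha i hi)) h)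

end WordBall

/-! ### Three-cycles of five points -/

theorem isThreeCycle_conj {ρ τ : Perm (Fin 5)} (hτ : τ.IsThreeCycle) :
    (ρ * τ * ρ⁻¹).IsThreeCycle := by
  rw [Perm.IsThreeCycle, Perm.cycleType_conj]
  exact hτ

/-- Any two three-cycles of five points are conjugate by an even permutation. -/
theorem exists_alternatingGroup_conj {σ τ : Perm (Fin 5)} (hσ : σ.IsThreeCycle)
    (hτ : τ.IsThreeCycle) : ∃ ρ ∈ alternatingGroup (Fin 5), ρ * σ * ρ⁻¹ = τ := by
  have := alternatingGroup.isThreeCycle_isConj (α := Fin 5) (by simp)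
    (σ := ⟨σ, Perm.mem_alternatingGroup.2 hσ.sign⟩) (τ := ⟨τ, Perm.mem_alternatingGroup.2 hτ.sign⟩)
    hσ hτ
  obtain ⟨c, hc⟩ := isConj_iff.1 this
  exact ⟨c, c.2, congrArg Subtype.val hc⟩

theorem exists_commutatorElement_eq {τ : Perm (Fin 5)} (hτ : τ.IsThreeCycle) :
    ∃ π₁ π₂ : Perm (Fin 5), π₁.IsThreeCycle ∧ π₂.IsThreeCycle ∧ ⁅π₁, π₂⁆ = τ := by
  -- Two three-cycles with a single common point have a three-cycle as commutator.
  have h₁ : (swap (0 : Fin 5) 1 * swap 0 2).IsThreeCycle :=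
    Perm.isThreeCycle_swap_mul_swap_same (by decide) (by decide) (by decide)
  have h₂ : (swap (0 : Fin 5) 3 * swap 0 4).IsThreeCycle :=
    Perm.isThreeCycle_swap_mul_swap_same (by decide) (by decide) (by decide)
  have h₃ : ∃ j k : Fin 5, 0 ≠ j ∧ 0 ≠ k ∧ j ≠ k ∧
      ⁅swap (0 : Fin 5) 1 * swap 0 2, swap 0 3 * swap 0 4⁆ = swap 0 j * swap 0 k := by decide
  obtain ⟨j, k, hj, hk, hjk, h⟩ := h₃
  obtain ⟨ρ, -, hρ⟩ := exists_alternatingGroup_conj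
    (h ▸ Perm.isThreeCycle_swap_mul_swap_same hj hk hjk) hτ
  refine ⟨_, _, isThreeCycle_conj (ρ := ρ) h₁, isThreeCycle_conj (ρ := ρ) h₂, ?_⟩
  rw [← hρ, ← conjugate_commutatorElement]

theorem exists_alternatingGroup_conj_apply_eq {τ : Perm (Fin 5)} (hτ : τ.IsThreeCycle)
    (i : Fin 5) : ∃ ρ ∈ alternatingGroup (Fin 5), (ρ * τ * ρ⁻¹) i = i := by
  have h : ∀ i : Fin 5, ∃ j k l : Fin 5, j ≠ k ∧ j ≠ l ∧ k ≠ l ∧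
      (swap j k * swap j l) i = i := by decide
  obtain ⟨j, k, l, h₁, h₂, h₃, hi⟩ := h i
  obtain ⟨ρ, hρ, e⟩ := exists_alternatingGroup_conj hτ
    (Perm.isThreeCycle_swap_mul_swap_same h₁ h₂ h₃)
  exact ⟨ρ, hρ, e ▸ hi⟩

/-! ### Permutations of the levels of a tower -/

section Tower

variable {X : Type*} [TopologicalSpace X] {φ : X ≃ₜ X} {U V D : Set X}

theorem zpow_add_apply (φ : X ≃ₜ X) (m n : ℤ) (y : X) :
    (φ ^ (m + n)) y = (φ ^ m) ((φ ^ n) y) := by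
  rw [zpow_add]
  rfl

/-- The sets `U, φ U, …, φ⁴ U` are pairwise disjoint. As each `φ ^ i` is injective, this amounts
to the injectivity of `(u, i) ↦ φ ^ i u` on `U × {0, …, 4}`. -/
def IsTower (φ : X ≃ₜ X) (U : Set X) : Prop :=
  Function.Injective fun p : U × Fin 5 => (φ ^ (p.2 : ℤ)) (p.1 : X)

theorem IsTower.mono (hD : IsTower φ D) (hU : U ⊆ D) : IsTower φ U := by
  rintro ⟨u, i⟩ ⟨v, j⟩ h
  have := @hD (⟨u, hU u.2⟩, i) (⟨v, hU v.2⟩, j) h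
  simp only [Prod.mk.injEq, Subtype.mk.injEq] at this
  exact Prod.ext (Subtype.ext this.1) this.2

theorem IsTower.eq_and_eq (hU : IsTower φ U) {u v : X} (hu : u ∈ U) (hv : v ∈ U) {i j : Fin 5}
    (h : (φ ^ (i : ℤ)) u = (φ ^ (j : ℤ)) v) : u = v ∧ i = j := by
  have := @hU (⟨u, hu⟩, i) (⟨v, hv⟩, j) h
  simpa using this

/-- The action of `Perm (Fin 5)` on `X` that permutes the levels of the tower over `U` and fixes
all points outside the tower: `π` sends `φ ^ i u` to `φ ^ (π i) u`. -/
noncomputable def IsTower.perm (hU : IsTower φ U) : Perm (Fin 5) →* Perm X :=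
  (Perm.viaEmbeddingHom ⟨fun p : U × Fin 5 => (φ ^ (p.2 : ℤ)) (p.1 : X), hU⟩).comp
    { toFun := fun π => prodCongrRight fun _ => π
      map_one' := rfl
      map_mul' := fun _ _ => rfl }

theorem IsTower.perm_apply (hU : IsTower φ U) (π : Perm (Fin 5)) {u : X} (hu : u ∈ U)
    (i : Fin 5) : hU.perm π ((φ ^ (i : ℤ)) u) = (φ ^ (π i : ℤ)) u :=
  Perm.viaEmbedding_apply (prodCongrRight fun _ => π)
    ⟨fun p : U × Fin 5 => (φ ^ (p.2 : ℤ)) (p.1 : X), hU⟩ (⟨u, hu⟩, i)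

theorem IsTower.perm_apply_of_forall_ne (hU : IsTower φ U) (π : Perm (Fin 5)) {y : X}
    (hy : ∀ u ∈ U, ∀ i, π i ≠ i → y ≠ (φ ^ (i : ℤ)) u) : hU.perm π y = y := by
  by_cases h : ∃ u ∈ U, ∃ i : Fin 5, y = (φ ^ (i : ℤ)) u
  · obtain ⟨u, hu, i, rfl⟩ := h
    rw [hU.perm_apply π hu, not_not.1 fun hi => hy u hu i hi rfl]
  · refine Perm.viaEmbedding_apply_of_notMem _ _ _ ?_
    rintro ⟨⟨u, i⟩, rfl⟩
    exact h ⟨u, u.2, i, rfl⟩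

open Classical in
/-- Over a sub-base `U` of a tower with base `D`, the action on the points of the big tower. -/
theorem IsTower.perm_apply_of_subset (hD : IsTower φ D) (hU : IsTower φ U) (hUD : U ⊆ D)
    (π : Perm (Fin 5)) {d : X} (hd : d ∈ D) (i : Fin 5) :
    hU.perm π ((φ ^ (i : ℤ)) d) =
      (φ ^ (((if d ∈ U then π else 1 : Perm (Fin 5)) i : Fin 5) : ℤ)) d := by
  split_ifs with h
  · exact hU.perm_apply π h i
  · refine hU.perm_apply_of_forall_ne π fun u hu j _ e => h ?_
    rwa [(hD.eq_and_eq hd (hUD hu) e).1]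

theorem perm_ext_of_levels {f g : Perm X}
    (h : ∀ d ∈ D, ∀ i : Fin 5, f ((φ ^ (i : ℤ)) d) = g ((φ ^ (i : ℤ)) d))
    (h' : ∀ y, (∀ d ∈ D, ∀ i : Fin 5, y ≠ (φ ^ (i : ℤ)) d) → f y = g y) : f = g := by
  ext y
  by_cases hy : ∃ d ∈ D, ∃ i : Fin 5, y = (φ ^ (i : ℤ)) d
  · obtain ⟨d, hd, i, rfl⟩ := hy
    exact h d hd i
  · push Not at hy
    exact h' y hy

/-- A level permutation over `U` and one over `V` act on the orbit segments starting outside `U ∩ V`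
through at most one nontrivial permutation, so their commutator is supported over `U ∩ V`. -/
theorem IsTower.commutatorElement_perm (hD : IsTower φ D) (hU : IsTower φ U) (hV : IsTower φ V)
    (hUV : IsTower φ (U ∩ V)) (hUD : U ⊆ D) (hVD : V ⊆ D) (π τ : Perm (Fin 5)) :
    ⁅hU.perm π, hV.perm τ⁆ = hUV.perm ⁅π, τ⁆ := by
  classical
  rw [commutatorElement_def, ← map_inv, ← map_inv]
  refine perm_ext_of_levels (φ := φ) (D := D) (fun d hd i => ?_) fun y hy => ?_
  · simp only [Perm.coe_mul, Function.comp_apply, hD.perm_apply_of_subset hU hUD _ hd,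
      hD.perm_apply_of_subset hV hVD _ hd,
      hD.perm_apply_of_subset hUV (Set.inter_subset_left.trans hUD) _ hd]
    congr 1
    by_cases h₁ : d ∈ U <;> by_cases h₂ : d ∈ V <;> simp [h₁, h₂, commutatorElement_def]
  · have hU' : ∀ π, hU.perm π y = y := fun π =>
      hU.perm_apply_of_forall_ne π fun u hu j _ => hy u (hUD hu) j
    have hV' : ∀ π, hV.perm π y = y := fun π =>
      hV.perm_apply_of_forall_ne π fun u hu j _ => hy u (hVD hu) j
    rw [hUV.perm_apply_of_forall_ne _ fun u hu j _ => hy u (hUD hu.1) j]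
    simp only [Perm.coe_mul, Function.comp_apply, hU', hV']

theorem IsTower.perm_conj (hD : IsTower φ D) (hU : IsTower φ U) (hUD : U ⊆ D)
    (ρ π : Perm (Fin 5)) :
    hD.perm ρ * hU.perm π * (hD.perm ρ)⁻¹ = hU.perm (ρ * π * ρ⁻¹) := by
  classical
  rw [← map_inv]
  refine perm_ext_of_levels (φ := φ) (D := D) (fun d hd i => ?_) fun y hy => ?_
  · simp only [Perm.coe_mul, Function.comp_apply, hD.perm_apply_of_subset hU hUD _ hd,
      hD.perm_apply _ hd]
    congr 1
    by_cases h₁ : d ∈ U <;> simp [h₁]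
  · have hD' : ∀ π, hD.perm π y = y := fun π =>
      hD.perm_apply_of_forall_ne π fun u hu j _ => hy u hu j
    have hU' : ∀ π, hU.perm π y = y := fun π =>
      hU.perm_apply_of_forall_ne π fun u hu j _ => hy u (hUD hu) j
    simp only [Perm.coe_mul, Function.comp_apply, hD', hU']

theorem IsTower.perm_mul_comm (hD : IsTower φ D) (hU : IsTower φ U) (hV : IsTower φ V)
    (hUD : U ⊆ D) (hVD : V ⊆ D) (hdisj : Disjoint U V) (π τ : Perm (Fin 5)) :
    hU.perm π * hV.perm τ = hV.perm τ * hU.perm π := by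
  classical
  refine perm_ext_of_levels (φ := φ) (D := D) (fun d hd i => ?_) fun y hy => ?_
  · simp only [Perm.coe_mul, Function.comp_apply, hD.perm_apply_of_subset hU hUD _ hd,
      hD.perm_apply_of_subset hV hVD _ hd]
    congr 1
    by_cases h₁ : d ∈ U
    · simp [h₁, Set.disjoint_left.1 hdisj h₁]
    · simp [h₁]
  · have hU' : ∀ π, hU.perm π y = y := fun π =>
      hU.perm_apply_of_forall_ne π fun u hu j _ => hy u (hUD hu) j
    have hV' : ∀ π, hV.perm π y = y := fun π =>
      hV.perm_apply_of_forall_ne π fun u hu j _ => hy u (hVD hu) j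
    simp only [Perm.coe_mul, Function.comp_apply, hU', hV']

theorem IsTower.perm_injective (hU : IsTower φ U) (hne : U.Nonempty) :
    Function.Injective hU.perm := by
  obtain ⟨u, hu⟩ := hne
  intro π τ h
  ext1 i
  have := congrArg (fun f : Perm X => f ((φ ^ (i : ℤ)) u)) h
  simp only [hU.perm_apply _ hu] at this
  exact (hU.eq_and_eq hu hu this).2

/-- A permutation of the levels of the tower over `φ U` that fixes the top level is also a
permutation of the levels of the tower over `U`, fixing the bottom level. -/
theorem IsTower.perm_image (hU : IsTower φ U) (hU' : IsTower φ (φ '' U)) {τ : Perm (Fin 5)}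
    (hτ : τ 4 = 4) : hU'.perm τ = hU.perm (finRotate 5 * τ * (finRotate 5)⁻¹) := by
  have hstep : ∀ u (j : ℤ), (φ ^ (j + 1)) u = (φ ^ j) (φ u) := fun u j => by
    rw [zpow_add_apply, zpow_one]
  have hrot : ∀ j : Fin 5, j ≠ 4 → ((finRotate 5 j : Fin 5) : ℤ) = (j : ℤ) + 1 := by decide
  refine perm_ext_of_levels (φ := φ) (D := U) (fun u hu i => ?_) fun y hy => ?_
  · rw [hU.perm_apply _ hu]
    obtain ⟨j, rfl⟩ := (finRotate 5).surjective i
    rw [Perm.mul_apply, Perm.mul_apply, Equiv.Perm.inv_def, symm_apply_apply]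
    by_cases hj : j = 4
    · subst hj
      rw [hτ]
      refine hU'.perm_apply_of_forall_ne τ ?_
      rintro _ ⟨v, hv, rfl⟩ l hl e
      have hl4 : l ≠ 4 := fun h => hl (h ▸ hτ)
      rw [← hstep, ← hrot l hl4] at e
      exact hl4 ((finRotate 5).injective (hU.eq_and_eq hu hv e).2).symm
    · have hj' : τ j ≠ 4 := fun h => hj (τ.injective (h.trans hτ.symm))
      rw [hrot j hj, hrot _ hj', hstep, hstep, hU'.perm_apply τ ⟨u, hu, rfl⟩]
  · rw [hU.perm_apply_of_forall_ne _ fun u hu j _ => hy u hu j]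
    refine hU'.perm_apply_of_forall_ne τ ?_
    rintro _ ⟨v, hv, rfl⟩ l hl
    rw [← hstep, ← hrot l fun h => hl (h ▸ hτ)]
    exact hy v hv _

/-! ### Level permutations in the topological full group -/

/-- The topological full group as a group of permutations of the underlying set. -/
def fullGroupPerm (φ : X ≃ₜ X) : topologicalFullGroup φ →* Perm X where
  toFun g := g.1.toEquiv
  map_one' := rfl
  map_mul' _ _ := rfl

theorem fullGroupPerm_injective (φ : X ≃ₜ X) : Function.Injective (fullGroupPerm φ) := by
  intro g h e
  refine Subtype.ext (Homeomorph.ext fun y => ?_)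
  exact congrArg (fun f : Perm X => f y) e

theorem continuous_zpow_apply {f : X → ℤ} (hf : Continuous f) :
    Continuous fun y => (φ ^ f y) y := by
  rw [continuous_iff_continuousAt]
  intro y
  refine ((φ ^ f y).continuous.continuousAt).congr ?_
  filter_upwards [hf.continuousAt.eventually_mem ((isOpen_discrete {f y}).mem_nhds rfl)] with z hz
  rw [hz]

/-- Over a clopen base, a level permutation has a locally constant orbit cocycle. -/
theorem IsTower.exists_cocycle (hU : IsTower φ U) (hUc : IsClopen U) (π : Perm (Fin 5)) :
    ∃ f : X → ℤ, Continuous f ∧ ∀ y, hU.perm π y = (φ ^ f y) y := by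
  classical
  -- At most one summand is nonzero: the one for the level that contains `y`.
  refine ⟨fun y => ∑ i : Fin 5, if (φ ^ (-(i : ℤ))) y ∈ U then (π i : ℤ) - i else 0, ?_, ?_⟩
  · refine continuous_finsetSum _ fun i _ => ?_
    have hc : IsClopen ((φ ^ (-(i : ℤ))) ⁻¹' U) := hUc.preimage (φ ^ (-(i : ℤ))).continuous
    refine continuous_const.if (fun y hy => ?_) continuous_const
    rw [show frontier {y | (φ ^ (-(i : ℤ))) y ∈ U} = ∅ from hc.frontier_eq] at hy
    exact hy.elim
  · intro y
    beta_reduce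
    have hneg : ∀ (i : ℤ) z, (φ ^ i) ((φ ^ (-i)) z) = z := fun i z => by
      rw [← zpow_add_apply]
      simp
    have hneg' : ∀ (i : ℤ) z, (φ ^ (-i)) ((φ ^ i) z) = z := fun i z => by
      rw [← zpow_add_apply]
      simp
    by_cases h : ∃ u ∈ U, ∃ i : Fin 5, y = (φ ^ (i : ℤ)) u
    · obtain ⟨u, hu, i, rfl⟩ := h
      rw [hU.perm_apply π hu, Finset.sum_eq_single i, hneg', if_pos hu, ← zpow_add_apply]
      · congr 2
        ring
      · intro j _ hj
        refine if_neg fun hm => hj (hU.eq_and_eq hm hu ?_).2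
        rw [hneg]
      · simp
    · push Not at h
      rw [hU.perm_apply_of_forall_ne π fun u hu i _ => h u hu i, Finset.sum_eq_zero]
      · simp
      · intro i _
        exact if_neg fun hm => h _ hm i (hneg _ _).symm

theorem IsTower.perm_mem_range (hU : IsTower φ U) (hUc : IsClopen U) (π : Perm (Fin 5)) :
    hU.perm π ∈ (fullGroupPerm φ).range := by
  have hcont : ∀ π, Continuous (hU.perm π) := fun π => by
    obtain ⟨f, hf, h⟩ := hU.exists_cocycle hUc π
    rw [show (hU.perm π : X → X) = fun y => (φ ^ f y) y from funext h]
    exact continuous_zpow_apply hf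
  have hinv : Continuous (hU.perm π).symm := by
    have := hcont π⁻¹
    rwa [map_inv] at this
  exact ⟨⟨⟨hU.perm π, hcont π, hinv⟩, hU.exists_cocycle hUc π⟩, rfl⟩

/-- The derived subgroup of the topological full group as a group of permutations. -/
def derivedPerm (φ : X ≃ₜ X) : commutator (topologicalFullGroup φ) →* Perm X :=
  (fullGroupPerm φ).comp (commutator (topologicalFullGroup φ)).subtype

theorem derivedPerm_injective (φ : X ≃ₜ X) : Function.Injective (derivedPerm φ) :=
  (fullGroupPerm_injective φ).comp Subtype.val_injective

/-- Even level permutations over a clopen base lie in the derived subgroup, as the alternating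
group is the derived subgroup of the symmetric group. -/
theorem IsTower.perm_mem_derived (hU : IsTower φ U) (hUc : IsClopen U) {π : Perm (Fin 5)}
    (hπ : π ∈ alternatingGroup (Fin 5)) : ∃ g, derivedPerm φ g = hU.perm π := by
  rw [← alternatingGroup.commutator_perm_eq (by simp)] at hπ
  have h₁ : hU.perm π ∈ (commutator (Perm (Fin 5))).map hU.perm := ⟨π, hπ, rfl⟩
  have h₂ : (commutator (Perm (Fin 5))).map hU.perm ≤
      (commutator (topologicalFullGroup φ)).map (fullGroupPerm φ) := by
    rw [commutator_def, commutator_def, Subgroup.map_commutator, Subgroup.map_commutator,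
      ← MonoidHom.range_eq_map, ← MonoidHom.range_eq_map]
    have : hU.perm.range ≤ (fullGroupPerm φ).range := by
      rintro _ ⟨π, rfl⟩
      exact hU.perm_mem_range hUc π
    exact Subgroup.commutator_mono this this
  obtain ⟨g, hg, e⟩ := h₂ h₁
  exact ⟨⟨g, hg⟩, e⟩

end Tower

/-! ### Word length of level permutations -/

section Length

variable {X : Type*} [TopologicalSpace X] {φ : X ≃ₜ X} {U V D : Set X}
  {S : Set (commutator (topologicalFullGroup φ))} {l l' : ℕ} {g h : Perm X}

/-- The ball of a word metric on the derived subgroup of the topological full group, as a set of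
permutations. -/
def permBall (S : Set (commutator (topologicalFullGroup φ))) (l : ℕ) : Set (Perm X) :=
  derivedPerm φ '' wordBall S l

theorem permBall_mono (hl : l ≤ l') (hg : g ∈ permBall S l) : g ∈ permBall S l' :=
  Set.image_mono (fun _ => wordBall_mono hl) hg

theorem mul_mem_permBall (hg : g ∈ permBall S l) (hh : h ∈ permBall S l') :
    g * h ∈ permBall S (l + l') := by
  obtain ⟨g, hg, rfl⟩ := hg
  obtain ⟨h, hh, rfl⟩ := hh
  exact ⟨g * h, mul_mem_wordBall hg hh, map_mul _ _ _⟩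

theorem inv_mem_permBall (hg : g ∈ permBall S l) : g⁻¹ ∈ permBall S l := by
  obtain ⟨g, hg, rfl⟩ := hg
  exact ⟨g⁻¹, inv_mem_wordBall hg, map_inv _ _⟩

/-- All three-cycles of the levels of the tower over `U` have word length at most `l`. -/
def IsTower.LengthLE (hU : IsTower φ U) (S : Set (commutator (topologicalFullGroup φ))) (l : ℕ) :
    Prop :=
  ∀ τ : Perm (Fin 5), τ.IsThreeCycle → hU.perm τ ∈ permBall S l

theorem IsTower.LengthLE.inter (hD : IsTower φ D) {hU : IsTower φ U} {hV : IsTower φ V}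
    (hUD : U ⊆ D) (hVD : V ⊆ D) (h₁ : hU.LengthLE S l) (h₂ : hV.LengthLE S l)
    (hUV : IsTower φ (U ∩ V)) : hUV.LengthLE S (4 * l) := by
  intro τ hτ
  obtain ⟨π₁, π₂, hπ₁, hπ₂, rfl⟩ := exists_commutatorElement_eq hτ
  rw [← hD.commutatorElement_perm hU hV hUV hUD hVD, commutatorElement_def]
  have a := h₁ _ hπ₁
  have b := h₂ _ hπ₂
  exact permBall_mono (by omega) (mul_mem_permBall (mul_mem_permBall (mul_mem_permBall a b)
    (inv_mem_permBall a)) (inv_mem_permBall b))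

theorem IsTower.perm_mem_permBall_of_conj (hD : IsTower φ D) (hU : IsTower φ U) (hUD : U ⊆ D)
    {ρ τ : Perm (Fin 5)} (hρ : hD.perm ρ ∈ permBall S l')
    (h : hU.perm (ρ * τ * ρ⁻¹) ∈ permBall S l) : hU.perm τ ∈ permBall S (l + 2 * l') := by
  rw [← hD.perm_conj hU hUD] at h
  have := mul_mem_permBall (mul_mem_permBall (inv_mem_permBall hρ) h) hρ
  refine permBall_mono (by omega) (?_ : _ ∈ permBall S (l' + l + l'))
  convert this using 1
  group

/-- Three-cycles over `φ U` that fix the top level are three-cycles over `U`; the others are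
conjugate to such ones inside the tower over `D`. -/
theorem IsTower.LengthLE.image {hU : IsTower φ U} (h : hU.LengthLE S l) (hD : IsTower φ D)
    (hl' : ∀ ρ ∈ alternatingGroup (Fin 5), hD.perm ρ ∈ permBall S l')
    (hUD : φ '' U ⊆ D) (hU' : IsTower φ (φ '' U)) : hU'.LengthLE S (l + 2 * l') := by
  intro τ hτ
  obtain ⟨ρ, hρ, e⟩ := exists_alternatingGroup_conj_apply_eq hτ 4
  refine hD.perm_mem_permBall_of_conj hU' hUD (hl' ρ hρ) ?_
  rw [hU.perm_image hU' e]
  exact h _ (isThreeCycle_conj (isThreeCycle_conj hτ))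

theorem IsTower.LengthLE.of_image {hU' : IsTower φ (φ '' U)} (h : hU'.LengthLE S l)
    (hD : IsTower φ D) (hl' : ∀ ρ ∈ alternatingGroup (Fin 5), hD.perm ρ ∈ permBall S l')
    (hUD : U ⊆ D) (hU : IsTower φ U) : hU.LengthLE S (l + 2 * l') := by
  intro τ hτ
  obtain ⟨ρ, hρ, e⟩ := exists_alternatingGroup_conj_apply_eq hτ 0
  refine hD.perm_mem_permBall_of_conj hU hUD (hl' ρ hρ) ?_
  have h4 : finRotate 5 4 = 0 := by decide
  have h0 : (finRotate 5)⁻¹ 0 = 4 := by decide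
  have e' : ((finRotate 5)⁻¹ * (ρ * τ * ρ⁻¹) * (finRotate 5)⁻¹⁻¹) 4 = 4 := by
    rw [inv_inv, Perm.mul_apply, Perm.mul_apply, h4, e, h0]
  have := hU.perm_image hU' e'
  rw [show finRotate 5 * ((finRotate 5)⁻¹ * (ρ * τ * ρ⁻¹) * (finRotate 5)⁻¹⁻¹) * (finRotate 5)⁻¹ =
    ρ * τ * ρ⁻¹ by group] at this
  rw [← this]
  exact h _ (isThreeCycle_conj (isThreeCycle_conj hτ))

end Length

/-! ### Cylinder sets of the subshift -/

/-- In a uniformly recurrent word without the period `d`, every long window shows that `d` is not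
a period. -/
theorem UniformlyRecurrent.exists_ne {A : Type*} {x : ℤ → A} (hrec : UniformlyRecurrent x)
    (hper : NonPeriodic x) {d : ℕ} (hd : d ≠ 0) :
    ∃ M : ℕ, ∀ s : ℤ, ∃ j : ℕ, j + d < M ∧ x (s + j) ≠ x (s + j + d) := by
  obtain ⟨t, ht⟩ := not_forall.1 (hper d (by exact_mod_cast hd))
  obtain ⟨M, hM⟩ := hrec (d + 1)
  refine ⟨M, fun s => ?_⟩
  obtain ⟨j, hj, e⟩ := hM (fun i => x (t + (i : ℕ))) ⟨t, fun _ => rfl⟩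
    (fun i => x (s + (i : ℕ))) ⟨s, fun _ => rfl⟩
  refine ⟨j, by omega, fun h => ht ?_⟩
  have e₀ := e 0
  have e₁ := e (Fin.last d)
  simp only [Fin.val_zero, Nat.cast_zero, add_zero, Fin.val_last, Nat.cast_add, ← add_assoc]
    at e₀ e₁
  rw [e₀, e₁, h]

section Cylinder

variable {A : Type*} [TopologicalSpace A] {x : ℤ → A} {k a b : ℤ}

theorem subshift_zpow_apply (n : ℤ) (y : orbitClosure x) (i : ℤ) :
    ((subshift x ^ n) y).1 i = y.1 (i + n) := by
  have h1 : ∀ (z : orbitClosure x) i, (subshift x z).1 i = z.1 (i + 1) := fun _ _ => rfl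
  induction n generalizing i with
  | zero => simp
  | succ n ih =>
    rw [add_comm (n : ℤ) 1, zpow_add_apply, zpow_one, h1, ih, add_assoc]
  | pred n ih =>
    have := h1 ((subshift x ^ (-(n : ℤ) - 1)) y) (i - 1)
    rw [sub_add_cancel] at this
    rw [← this]
    have h2 := zpow_add_apply (subshift x) 1 (-(n : ℤ) - 1) y
    rw [zpow_one, add_sub_cancel] at h2
    rw [← h2, ih, sub_add_eq_add_sub, add_sub_assoc]

/-- The cylinder set of the points of the subshift that agree with the translate `σ ^ k x` at the
coordinates from `-a` to `b`. -/
def cylinder (x : ℤ → A) (k a b : ℤ) : Set (orbitClosure x) :=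
  {y | ∀ i, -a ≤ i → i ≤ b → y.1 i = x (k + i)}

theorem cylinder_subset {a' b' : ℤ} (ha : a' ≤ a) (hb : b' ≤ b) :
    cylinder x k a b ⊆ cylinder x k a' b' :=
  fun _ hy i h₁ h₂ => hy i (by omega) (by omega)

theorem cylinder_nonempty : (cylinder x k a b).Nonempty := by
  have hx : x ∈ orbitClosure x := subset_closure ⟨0, by simp⟩
  exact ⟨(subshift x ^ k) ⟨x, hx⟩, fun i _ _ => by rw [subshift_zpow_apply, add_comm]⟩

theorem image_subshift_cylinder :
    subshift x '' cylinder x k a b = cylinder x (k + 1) (a + 1) (b - 1) := by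
  ext z
  obtain ⟨y, rfl⟩ := (subshift x).surjective z
  have h1 : ∀ i, (subshift x y).1 i = y.1 (i + 1) := fun _ => rfl
  rw [(subshift x).injective.mem_set_image]
  constructor
  · intro h i h₁ h₂
    rw [h1, h (i + 1) (by omega) (by omega)]
    congr 1
    ring
  · intro h i h₁ h₂
    have := h (i - 1) (by omega) (by omega)
    rw [h1, sub_add_cancel] at this
    rw [this]
    congr 1
    ring

theorem cylinder_inter_cylinder {m n : ℤ} (hn : 0 ≤ n) (hm : 0 ≤ m) :
    cylinder x k (n + m) n ∩ cylinder x k n (n + m) = cylinder x k (n + m) (n + m) := by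
  ext y
  constructor
  · rintro ⟨h₁, h₂⟩ i hi hi'
    rcases le_total i 0 with h | h
    · exact h₁ i hi (by omega)
    · exact h₂ i (by omega) hi'
  · exact fun h => ⟨fun i hi hi' => h i hi (by omega), fun i hi hi' => h i (by omega) hi'⟩

theorem isClopen_cylinder [DiscreteTopology A] : IsClopen (cylinder x k a b) := by
  have : cylinder x k a b =
      ⋂ i ∈ Set.Icc (-a) b, (fun y : orbitClosure x => y.1 i) ⁻¹' {x (k + i)} := by
    ext y
    simp [cylinder]
  rw [this]
  refine (Set.finite_Icc (-a) b).isClopen_biInter fun i _ => ?_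
  exact (isClopen_discrete _).preimage ((continuous_apply i).comp continuous_subtype_val)

theorem cylinder_eq_or_disjoint (k k' : ℤ) :
    (∀ i, -a ≤ i → i ≤ b → x (k + i) = x (k' + i)) ∨
      Disjoint (cylinder x k a b) (cylinder x k' a b) := by
  by_cases h : Disjoint (cylinder x k a b) (cylinder x k' a b)
  · exact Or.inr h
  · obtain ⟨y, h₁, h₂⟩ := Set.not_disjoint_iff.1 h
    exact Or.inl fun i hi hi' => (h₁ i hi hi').symm.trans (h₂ i hi hi')

theorem cylinder_congr {k' : ℤ} (h : ∀ i, -a ≤ i → i ≤ b → x (k + i) = x (k' + i)) :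
    cylinder x k a b = cylinder x k' a b := by
  ext y
  refine forall_congr' fun i => forall_congr' fun hi => forall_congr' fun hi' => ?_
  rw [h i hi hi']

theorem finite_range_cylinder [Finite A] (a b : ℤ) :
    (Set.range fun k => cylinder x k a b).Finite := by
  have hf : (Set.range fun (k : ℤ) (i : Set.Icc (-a) b) => x (k + i)).Finite := Set.toFinite _
  refine (hf.image fun w => {y : orbitClosure x | ∀ i : Set.Icc (-a) b, y.1 i = w i}).subset ?_
  rintro _ ⟨k, rfl⟩
  refine ⟨_, ⟨k, rfl⟩, ?_⟩
  ext y
  simp [cylinder]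

/-- Long central cylinders are bases of towers, uniformly over the subshift. -/
theorem UniformlyRecurrent.exists_isTower (hrec : UniformlyRecurrent x) (hper : NonPeriodic x) :
    ∃ N : ℕ, ∀ k, IsTower (subshift x) (cylinder x k N N) := by
  choose! M hM using fun d (hd : d ≠ 0) => hrec.exists_ne hper (d := d) hd
  refine ⟨∑ d ∈ Finset.range 5, M d, fun k => ?_⟩
  set N := ∑ d ∈ Finset.range 5, M d with hN
  have hMN : ∀ d < 5, M d ≤ N := fun d hd =>
    Finset.single_le_sum (f := M) (fun _ _ => Nat.zero_le _) (Finset.mem_range.2 hd)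
  have key : ∀ y ∈ cylinder x k N N, ∀ y' ∈ cylinder x k N N, ∀ d : ℕ, d ≠ 0 → d < 5 →
      y ≠ (subshift x ^ (d : ℤ)) y' := by
    rintro y hy y' hy' d hd hd5 rfl
    obtain ⟨j, hj, hne⟩ := hM d hd (k - N)
    have := hMN d hd5
    have h₁ := hy (-N + j) (by omega) (by omega)
    have h₂ := hy' (-N + j + d) (by omega) (by omega)
    rw [subshift_zpow_apply, h₂] at h₁
    apply hne
    convert h₁.symm using 2 <;> ring
  have key' : ∀ y ∈ cylinder x k N N, ∀ y' ∈ cylinder x k N N, ∀ i j : Fin 5, i < j →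
      (subshift x ^ (i : ℤ)) y ≠ (subshift x ^ (j : ℤ)) y' := by
    intro y hy y' hy' i j hij h
    have hij' : (i : ℕ) < j := hij
    refine key y hy y' hy' (j - i) (by omega) (by omega) ((subshift x ^ (i : ℤ)).injective ?_)
    rw [h, ← zpow_add_apply]
    congr 2
    omega
  rintro ⟨y, i⟩ ⟨y', j⟩ h
  rcases lt_trichotomy i j with hij | rfl | hij
  · exact absurd h (key' y y.2 y' y'.2 i j hij)
  · exact Prod.ext (Subtype.ext ((subshift x ^ (i : ℤ)).injective h)) rfl
  · exact absurd h.symm (key' y' y'.2 y y.2 j i hij)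

end Cylinder

/-! ### Quadratic growth of the word length along cylinders -/

section Growth

variable {A : Type*} [TopologicalSpace A] {x : ℤ → A} {S : Set (derivedFullGroup x)} {N : ℕ}

/-- As there are finitely many cylinders of given size, their even level permutations have bounded
word length. -/
theorem exists_forall_perm_mem_permBall [Finite A] [DiscreteTopology A]
    (hS : Subgroup.closure S = ⊤) (a b : ℤ) :
    ∃ l : ℕ, ∀ (k : ℤ) (h : IsTower (subshift x) (cylinder x k a b)),
      ∀ ρ ∈ alternatingGroup (Fin 5), h.perm ρ ∈ permBall S l := by
  have h₁ : ∀ U : Set (orbitClosure x), IsClopen U → ∃ l : ℕ, ∀ (h : IsTower (subshift x) U),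
      ∀ ρ ∈ alternatingGroup (Fin 5), h.perm ρ ∈ permBall S l := by
    intro U hUc
    by_cases hU : IsTower (subshift x) U
    · have : ∀ ρ : Perm (Fin 5), ∃ l, ρ ∈ alternatingGroup (Fin 5) →
          hU.perm ρ ∈ permBall S l := by
        intro ρ
        by_cases hρ : ρ ∈ alternatingGroup (Fin 5)
        · obtain ⟨g, hg⟩ := hU.perm_mem_derived hUc hρ
          obtain ⟨l, hl⟩ := exists_mem_wordBall hS g
          exact ⟨l, fun _ => ⟨g, hl, hg⟩⟩
        · exact ⟨0, fun h => absurd h hρ⟩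
      choose l hl using this
      exact ⟨∑ ρ, l ρ, fun _ ρ hρ => permBall_mono
        (Finset.single_le_sum (fun _ _ => Nat.zero_le _) (Finset.mem_univ ρ)) (hl ρ hρ)⟩
    · exact ⟨0, fun h => absurd h hU⟩
  choose! l hl using h₁
  obtain ⟨L, hL⟩ := ((finite_range_cylinder (x := x) a b).image l).bddAbove
  exact ⟨L, fun k h ρ hρ => permBall_mono (hL ⟨_, ⟨k, rfl⟩, rfl⟩) (hl _ isClopen_cylinder h ρ hρ)⟩

theorem lengthLE_cylinder_forward
    (hN : ∀ k, IsTower (subshift x) (cylinder x k N N)) {c l : ℕ}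
    (hc : ∀ (k : ℤ), ∀ ρ ∈ alternatingGroup (Fin 5), (hN k).perm ρ ∈ permBall S c)
    (m : ℕ) {k a b : ℤ} (ha : N ≤ a) (hb : N ≤ b)
    (h₀ : ∀ h : IsTower (subshift x) (cylinder x k a (b + m)), h.LengthLE S l)
    (h : IsTower (subshift x) (cylinder x (k + m) (a + m) b)) : h.LengthLE S (l + 2 * c * m) := by
  induction m generalizing b with
  | zero => simpa using h₀ (by simpa using h)
  | succ m ih =>
    have hT : ∀ k a b : ℤ, N ≤ a → N ≤ b → IsTower (subshift x) (cylinder x k a b) :=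
      fun k a b ha hb => (hN k).mono (cylinder_subset ha hb)
    have h₁ := ih (b := b + 1) (by omega)
      (by rw [add_assoc, add_comm 1 (m : ℤ)]; exact_mod_cast h₀)
      (hT _ _ _ (by omega) (by omega))
    have e : subshift x '' cylinder x (k + m) (a + m) (b + 1) =
        cylinder x (k + (m + 1 : ℕ)) (a + (m + 1 : ℕ)) b := by
      rw [image_subshift_cylinder]
      push_cast
      simp [add_assoc]
    simp only [← e] at h ⊢
    rw [show l + 2 * c * (m + 1) = l + 2 * c * m + 2 * c by ring]
    refine h₁.image (hN (k + (m + 1 : ℕ))) (hc _) ?_ h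
    rw [e]
    exact cylinder_subset (by omega) hb

theorem lengthLE_cylinder_backward
    (hN : ∀ k, IsTower (subshift x) (cylinder x k N N)) {c l : ℕ}
    (hc : ∀ (k : ℤ), ∀ ρ ∈ alternatingGroup (Fin 5), (hN k).perm ρ ∈ permBall S c)
    (m : ℕ) {k a b : ℤ} (ha : N ≤ a) (hb : N ≤ b)
    (h₀ : ∀ h : IsTower (subshift x) (cylinder x (k + m) (a + m) b), h.LengthLE S l)
    (h : IsTower (subshift x) (cylinder x k a (b + m))) : h.LengthLE S (l + 2 * c * m) := by
  induction m generalizing k a b l with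
  | zero => simpa using h₀ (by simpa using h)
  | succ m ih =>
    have hT : ∀ k a b : ℤ, N ≤ a → N ≤ b → IsTower (subshift x) (cylinder x k a b) :=
      fun k a b ha hb => (hN k).mono (cylinder_subset ha hb)
    have e : subshift x '' cylinder x (k + m) (a + m) (b + 1) =
        cylinder x (k + (m + 1 : ℕ)) (a + (m + 1 : ℕ)) b := by
      rw [image_subshift_cylinder]
      push_cast
      simp [add_assoc]
    simp only [← e] at h₀
    have h₁ : ∀ h : IsTower (subshift x) (cylinder x (k + m) (a + m) (b + 1)),
        h.LengthLE S (l + 2 * c) := fun h =>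
      (h₀ (e ▸ hT _ _ _ (by omega) hb)).of_image (hN (k + m)) (hc _)
        (cylinder_subset (by omega) (by omega)) h
    have e' : b + 1 + (m : ℤ) = b + (m + 1 : ℕ) := by push_cast; ring
    have h₂ := ih (b := b + 1) ha (by omega) h₁ (hT _ _ _ ha (by omega))
    simp only [e'] at h₂
    rwa [show l + 2 * c * (m + 1) = l + 2 * c + 2 * c * m by ring]

/-- A cylinder of radius `N + 2m` is the intersection of two cylinders that are translates, by `m`
steps in either direction, of cylinders of radius `N + m`. -/
theorem lengthLE_cylinder_double
    (hN : ∀ k, IsTower (subshift x) (cylinder x k N N)) {c l : ℕ}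
    (hc : ∀ (k : ℤ), ∀ ρ ∈ alternatingGroup (Fin 5), (hN k).perm ρ ∈ permBall S c)
    (m : ℕ)
    (h₀ : ∀ (k : ℤ) (h : IsTower (subshift x) (cylinder x k (N + m) (N + m))), h.LengthLE S l)
    (k : ℤ) (h : IsTower (subshift x) (cylinder x k (N + (2 * m : ℕ)) (N + (2 * m : ℕ)))) :
    h.LengthLE S (4 * (l + 2 * c * m)) := by
  have hT : ∀ k a b : ℤ, N ≤ a → N ≤ b → IsTower (subshift x) (cylinder x k a b) :=
    fun k a b ha hb => (hN k).mono (cylinder_subset ha hb)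
  have e₁ : cylinder x (k - m + m) (N + m + m) N = cylinder x k (N + (2 * m : ℕ)) N := by
    push_cast
    congr 1 <;> ring
  have e₂ : cylinder x k N (N + m + m) = cylinder x k N (N + (2 * m : ℕ)) := by
    push_cast
    congr 1
    ring
  have h₁ := lengthLE_cylinder_forward hN hc m (k := k - m) (a := N + m) (b := N) (by omega) le_rfl
    (h₀ _) (hT _ _ _ (by omega) le_rfl)
  have h₂ := lengthLE_cylinder_backward hN hc m (k := k) (a := N) (b := N + m) le_rfl (by omega)
    (h₀ _) (hT _ _ _ le_rfl (by omega))
  simp only [e₁] at h₁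
  simp only [e₂] at h₂
  have e := cylinder_inter_cylinder (x := x) (k := k) (n := N) (m := (2 * m : ℕ)) (by omega)
    (by omega)
  simp only [← e] at h ⊢
  exact h₁.inter (hN k) (cylinder_subset (by omega) le_rfl) (cylinder_subset le_rfl (by omega)) h₂ h

/-- The level three-cycles over cylinders of radius `N + m` have word length `O(m²)`, for `m` a
power of two. -/
theorem exists_lengthLE_cylinder [Finite A] [DiscreteTopology A]
    (hN : ∀ k, IsTower (subshift x) (cylinder x k N N))
    (hS : Subgroup.closure S = ⊤) :
    ∃ C : ℕ, 0 < C ∧ ∀ (j : ℕ) (k : ℤ)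
      (h : IsTower (subshift x) (cylinder x k (N + (2 ^ j : ℕ)) (N + (2 ^ j : ℕ)))),
      h.LengthLE S (C * 4 ^ j) := by
  obtain ⟨c, hc⟩ := exists_forall_perm_mem_permBall hS (N : ℤ) (N : ℤ)
  obtain ⟨l, hl⟩ := exists_forall_perm_mem_permBall hS (N + (2 ^ 0 : ℕ)) (N + (2 ^ 0 : ℕ))
  -- The bound `l (m)` satisfies `l (2m) ≤ 4 (l (m) + 2cm)`, so `l (m) + 4cm` at most quadruples.
  have key : ∀ (j : ℕ), ∃ L : ℕ, L + 4 * c * 2 ^ j ≤ (l + 4 * c + 1) * 4 ^ j ∧ ∀ (k : ℤ)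
      (h : IsTower (subshift x) (cylinder x k (N + (2 ^ j : ℕ)) (N + (2 ^ j : ℕ)))),
      h.LengthLE S L := by
    intro j
    induction j with
    | zero =>
      exact ⟨l, by simp, fun k h τ hτ => hl k h τ (Perm.mem_alternatingGroup.2 hτ.sign)⟩
    | succ j ih =>
      obtain ⟨L, hL, h⟩ := ih
      refine ⟨4 * (L + 2 * c * 2 ^ j), ?_, ?_⟩
      · rw [pow_succ 4, pow_succ 2]
        nlinarith
      · have := lengthLE_cylinder_double hN (fun k => hc k (hN k)) (2 ^ j) h
        rw [pow_succ, mul_comm]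
        exact this
  refine ⟨l + 4 * c + 1, by omega, fun j k h τ hτ => ?_⟩
  obtain ⟨L, hL, hLj⟩ := key j
  exact permBall_mono (by omega) (hLj k h τ hτ)

end Growth

/-! ### Many disjoint cylinders in a common tower -/

/-- Many translates of `x` agree at the coordinates from `-N` to `N` but differ pairwise at some
coordinate from `-m` to `m - 1`, by the pigeonhole principle: each of the `p_x(s)` words of length
`s ≤ 2m` contributes a position where it occurs. -/
theorem exists_positions {A : Type*} [Finite A] (x : ℤ → A) {s m : ℕ} (N : ℕ) (hs : s ≤ 2 * m) :
    ∃ K : Finset ℤ, (complexity x s : ℝ) / (Nat.card A : ℝ) ^ (2 * N + 1) ≤ K.card ∧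
      (∀ k ∈ K, ∀ k' ∈ K, ∀ i : ℤ, -N ≤ i → i ≤ N → x (k + i) = x (k' + i)) ∧
      ∀ k ∈ K, ∀ k' ∈ K, (∀ i : ℤ, -m ≤ i → i < m → x (k + i) = x (k' + i)) → k = k' := by
  classical
  have := Fintype.ofFinite A
  have : Nonempty A := ⟨x 0⟩
  have hfin : (factors x s).Finite := Set.toFinite _
  choose! pos hpos using fun (w : Fin s → A) (hw : w ∈ factors x s) => hw
  have hpos' : ∀ w ∈ hfin.toFinset, ∀ i : Fin s, w i = x (pos w + (i : ℕ)) := fun w hw =>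
    hpos w (hfin.mem_toFinset.1 hw)
  obtain ⟨v, -, hv⟩ := Finset.exists_le_card_fiber_of_nsmul_le_card_of_maps_to
    (s := hfin.toFinset) (t := (Finset.univ : Finset (Fin (2 * N + 1) → A)))
    (f := fun w i => x (pos w + m + (-N + (i : ℕ))))
    (b := (complexity x s : ℝ) / (Nat.card A : ℝ) ^ (2 * N + 1))
    (fun _ _ => Finset.mem_univ _) Finset.univ_nonempty (by
      rw [Finset.card_univ, Fintype.card_fun, Fintype.card_fin, nsmul_eq_mul, Nat.cast_pow,
        ← Nat.card_eq_fintype_card, mul_div_cancel₀, complexity, Set.ncard_eq_toFinset_card _ hfin]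
      exact pow_ne_zero _ (Nat.cast_ne_zero.2 Nat.card_pos.ne'))
  set T := hfin.toFinset.filter fun w => (fun i : Fin (2 * N + 1) =>
    x (pos w + m + (-N + (i : ℕ)))) = v with hT
  have hinj : ∀ w ∈ T, ∀ w' ∈ T, (∀ i : ℤ, -m ≤ i → i < m →
      x (pos w + m + i) = x (pos w' + m + i)) → w = w' := by
    intro w hw w' hw' h
    ext i
    rw [hpos' w (Finset.mem_filter.1 hw).1, hpos' w' (Finset.mem_filter.1 hw').1]
    have := h (-m + (i : ℕ)) (by omega) (by omega)
    simpa [add_assoc] using this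
  refine ⟨T.image fun w => pos w + m, ?_, ?_, ?_⟩
  · rwa [Finset.card_image_of_injOn]
    intro w hw w' hw' h
    exact hinj w hw w' hw' fun i _ _ => by rw [show pos w + m = pos w' + m from h]
  · simp only [Finset.mem_image]
    rintro _ ⟨w, hw, rfl⟩ _ ⟨w', hw', rfl⟩ i hi hi'
    have h := (Finset.mem_filter.1 hw).2.trans (Finset.mem_filter.1 hw').2.symm
    obtain ⟨j, hj⟩ := Int.eq_ofNat_of_zero_le (show 0 ≤ i + N by omega)
    have := congrFun h ⟨j, by omega⟩
    rwa [show i = -N + (j : ℤ) by omega]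
  · simp only [Finset.mem_image]
    rintro _ ⟨w, hw, rfl⟩ _ ⟨w', hw', rfl⟩ h
    rw [hinj w hw w' hw' h]

/-- Two non-commuting three-cycles over each of a family of disjoint cylinders inside a common
tower bound the LEF growth from below. -/
theorem two_pow_card_le_lefGrowth_of_lengthLE {A : Type*} [TopologicalSpace A] {x : ℤ → A}
    {S : Set (derivedFullGroup x)} {D : Set (orbitClosure x)} (hD : IsTower (subshift x) D)
    {ι : Type*} (K : Finset ι) (U : ι → Set (orbitClosure x)) {l m : ℕ}
    (hU : ∀ k, IsTower (subshift x) (U k)) (hne : ∀ k, (U k).Nonempty) (hUD : ∀ k ∈ K, U k ⊆ D)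
    (hdisj : ∀ k ∈ K, ∀ k' ∈ K, k ≠ k' → Disjoint (U k) (U k'))
    (hl : ∀ k, (hU k).LengthLE S l) (hm : 2 * l ≤ m) :
    ((2 ^ K.card : ℕ) : ℕ∞) ≤ lefGrowth S m := by
  have h₁ : (swap (0 : Fin 5) 1 * swap 0 2).IsThreeCycle :=
    Perm.isThreeCycle_swap_mul_swap_same (by decide) (by decide) (by decide)
  have h₂ : (swap (0 : Fin 5) 1 * swap 0 3).IsThreeCycle :=
    Perm.isThreeCycle_swap_mul_swap_same (by decide) (by decide) (by decide)
  choose a ha ea using fun k => hl k _ h₁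
  choose b hb eb using fun k => hl k _ h₂
  refine two_pow_card_le_lefGrowth a b K (fun k _ => ha k) (fun k _ => hb k) ?_ ?_ hm
  · intro k hk k' hk' hkk'
    apply derivedPerm_injective
    rw [map_mul, map_mul, ea, eb]
    exact hD.perm_mul_comm (hU k) (hU k') (hUD k hk) (hUD k' hk') (hdisj k hk k' hk' hkk') _ _
  · intro k _ h
    have h' := congrArg (derivedPerm (subshift x)) h
    rw [map_mul, map_mul, ea, eb, ← map_mul, ← map_mul] at h'
    exact absurd ((hU k).perm_injective (hne k) h') (by decide)

end LEFGrowth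

theorem mainTheorem2 {A : Type*} [Finite A] [TopologicalSpace A] [DiscreteTopology A]
    (x : ℤ → A) (hrec : LEFGrowth.UniformlyRecurrent x) (hper : LEFGrowth.NonPeriodic x) :
    ∃ c : ℝ, 0 < c ∧
      ∀ S : Set (LEFGrowth.derivedFullGroup x), S.Finite → Subgroup.closure S = ⊤ →
        LEFGrowth.GrowthLE
          (fun n => ENNReal.ofReal
            (Real.exp (c * (LEFGrowth.complexity x (Nat.sqrt n) : ℝ))))
          (fun n => (LEFGrowth.lefGrowth S n : ENNReal)) := by
  open LEFGrowth in
  have : Nonempty A := ⟨x 0⟩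
  obtain ⟨N, hN⟩ := hrec.exists_isTower hper
  have hA : (0 : ℝ) < (Nat.card A : ℝ) ^ (2 * N + 1) :=
    pow_pos (Nat.cast_pos.2 Nat.card_pos) _
  refine ⟨Real.log 2 / (Nat.card A : ℝ) ^ (2 * N + 1), div_pos (Real.log_pos one_lt_two) hA,
    fun S _ hS => ?_⟩
  obtain ⟨C, hC, hlen⟩ := exists_lengthLE_cylinder hN hS
  refine ⟨2 * C, by omega, fun n hn => ?_⟩
  -- The radius `2 ^ j` of the cylinders satisfies `√n / 2 < 2 ^ j ≤ √n`.
  set j := Nat.log 2 n.sqrt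
  have hj : 2 ^ j ≤ n.sqrt := Nat.pow_log_le_self 2 (Nat.sqrt_pos.2 hn).ne'
  have hj' : n.sqrt ≤ 2 * 2 ^ j := by
    have := (Nat.lt_pow_succ_log_self one_lt_two n.sqrt).le
    rwa [pow_succ, mul_comm] at this
  have h4 : 4 ^ j ≤ n := calc
    4 ^ j = 2 ^ j * 2 ^ j := by rw [← mul_pow, show 2 * 2 = 4 from rfl]
    _ ≤ n.sqrt * n.sqrt := Nat.mul_le_mul hj hj
    _ ≤ n := Nat.sqrt_le n
  obtain ⟨K, hK, hK₁, hK₂⟩ := exists_positions x N hj'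
  have hT : ∀ k, IsTower (subshift x) (cylinder x k (N + (2 ^ j : ℕ)) (N + (2 ^ j : ℕ))) :=
    fun k => (hN k).mono (cylinder_subset (by omega) (by omega))
  have hmain : ((2 ^ K.card : ℕ) : ℕ∞) ≤ lefGrowth S (2 * C * n) := by
    rcases K.eq_empty_or_nonempty with rfl | ⟨k₀, hk₀⟩
    · exact two_pow_card_le_lefGrowth_of_lengthLE (hN 0) ∅ _ hT (fun _ => cylinder_nonempty)
        (by simp) (by simp) (fun k => hlen j k (hT k)) (by nlinarith)
    · refine two_pow_card_le_lefGrowth_of_lengthLE (hN k₀) K _ hT (fun _ => cylinder_nonempty)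
        (fun k hk => ?_) (fun k hk k' hk' hkk' => ?_) (fun k => hlen j k (hT k)) (by nlinarith)
      · rw [← cylinder_congr (hK₁ k hk k₀ hk₀)]
        exact cylinder_subset (by omega) (by omega)
      · refine (cylinder_eq_or_disjoint k k').resolve_left fun h => hkk' ?_
        exact hK₂ k hk k' hk' fun i hi hi' => h i (by omega) (by omega)
  have hexp : Real.exp (Real.log 2 / (Nat.card A : ℝ) ^ (2 * N + 1) * complexity x n.sqrt) ≤
      ((2 ^ K.card : ℕ) : ℝ) := by
    have e : ((2 ^ K.card : ℕ) : ℝ) = Real.exp (K.card * Real.log 2) := by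
      rw [Real.exp_nat_mul, Real.exp_log two_pos]
      simp
    rw [e, Real.exp_le_exp, div_mul_eq_mul_div, mul_div_assoc, mul_comm]
    exact mul_le_mul_of_nonneg_right hK (Real.log_pos one_lt_two).le
  calc ENNReal.ofReal _ ≤ ENNReal.ofReal ((2 ^ K.card : ℕ) : ℝ) := ENNReal.ofReal_le_ofReal hexp
    _ = (((2 ^ K.card : ℕ) : ℕ∞) : ℝ≥0∞) := by rw [ENNReal.ofReal_natCast, ENat.toENNReal_coe]
    _ ≤ _ := ENat.toENNReal_le.2 hmain
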